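/- **Theorem (approximation of the in-context conditioning operator).** Let $D\subset\mathbb{R}^m$ and $E\subset\mathbb{R}^r$ be compact sets with Lipschitz boundaries (near each boundary point the set is, in suitable orthonormal coordinates, the closed epigraph of a Lipschitz function). For $\rho\in C(D\times E)$ let $m_\rho(y)=\int_D\rho(x,y)\,dx$, and for $\delta>0$ let $\mathcal{X}_\delta$ be the set of all $\rho\in C(D\times E)$ with $\rho\ge 0$, $\int_{D\times E}\rho=1$ and $m_\rho(y)\ge\delta$ for all $y\in E$. The in-context conditioning operator is $$\Psi^\star\colon\mathcal{X}_\delta\times E\to C(D),\qquad \Psi^\star(\rho,y)=\rho(\,\cdot\,|\,y)=\frac{\rho(\,\cdot\,,y)}{m_\rho(y)}.$$ Fix a nonlinearity $\sigma\colon\mathbb{R}\to\mathbb{R}$, that is, a continuous function that is not affine; it acts on vectors coordinatewise. A *neural network* is an alternating composition of affine maps and of $\sigma$, beginning and ending with an affine map, with any finite number (possibly zero) of applications of $\sigma$ and any widths. A *neural operator* of depth $L>0$ from functions on $\Omega=D\times E$ to functions on $D$ is a map $\mathcal{Q}\circ\mathcal{L}_L\circ\cdots\circ\mathcal{L}_1\circ\mathcal{R}$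 of the following form. The lifting layer is $\mathcal{R}(f)(x)=R(x,f(x))$, $x\in\Omega$, with a neural network $R$. For $\ell<L$ the hidden layer $\mathcal{L}_\ell$ maps $C(\Omega;\mathbb{R}^{d_{\ell-1}})$ to $C(\Omega;\mathbb{R}^{d_\ell})$ by $$\mathcal{L}_\ell(f)(x)=\sigma\Bigl(W_\ell f(x)+b_\ell+\sum_{j=1}^{M_\ell}\langle T_{\ell,j}f,\psi_{\ell,j}\rangle_{L^2(\Omega;\mathbb{R}^{d_{\ell-1}})}\,\phi_{\ell,j}(x)\Bigr),$$ with matrices $W_\ell\in\mathbb{R}^{d_\ell\times d_{\ell-1}}$, $T_{\ell,j}\in\mathbb{R}^{d_{\ell-1}\times d_{\ell-1}}$, vectors $b_\ell\in\mathbb{R}^{d_\ell}$ and continuous functions $\psi_{\ell,j}\colon\Omega\to\mathbb{R}^{d_{\ell-1}}$, $\phi_{\ell,j}\colon\Omega\to\mathbb{R}^{d_\ell}$. The last hidden layer $\mathcal{L}_L$ maps $C(\Omega;\mathbb{R}^{d_{L-1}})$ to $C(D;\mathbb{R}^{d_L})$ by the same formula, with $x\in D$, continuous $\phi_{L,j}\colon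 D\to\mathbb{R}^{d_L}$, and without the local term $W_Lf(x)$. The projection layer is $\mathcal{Q}(f)(x)=Q(x,f(x))$, $x\in D$, with a neural network $Q$. An *augmented neural operator* of depth $L$ with input space $C(D\times E)$, vector set $E$ and output space $C(D)$ is a map $$\widetilde\Psi\colon C(D\times E)\times E\to C(D),\qquad \widetilde\Psi(f,z)=\Psi\bigl(f\oplus V(z)\bigr),$$ where $(f\oplus V(z))(x)=(f(x),V(z)(x))$, $\Psi$ is a neural operator of depth $L$, and $V(z)(x)=h(x)\psi(z)$ with $h\in C(D\times E)$ and $\psi$ either a neural network $\mathbb{R}^r\to\mathbb{R}$ or the identity of $\mathbb{R}^r$. Then for every $\delta>0$, every set $K\subseteq\mathcal{X}_\delta$ that is compact in $C(D\times E)$ with the supremum norm, and every $\varepsilon>0$, there is an augmented neural operator $\widetilde\Psi$ of some depth $L>0$ with input space $C(D\times E)$, vector set $E$ and output space $C(D)$ such that $$\sup_{(\rho,y)\in K\times E}\bigl\|\Psi^\star(\rho,y)-\widetilde\Psi(\rho,y)\bigr\|_{C(D)}\le\varepsilon .$$ -/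

import Mathlib

open MeasureTheory
open scoped Matrix

namespace Conditioning

/-! ### Lipschitz boundaries, products, densities, conditioning -/

/-- `S` has a Lipschitz boundary: near each boundary point, `S` is the closed epigraph of a
Lipschitz function over the hyperplane orthogonal to some unit vector `e`; the point
`x - ⟪e, x⟫ e` is the orthogonal projection of `x` to that hyperplane. -/
def HasLipschitzBoundary {ι : Type} [Fintype ι] (S : Set (EuclideanSpace ℝ ι)) : Prop :=
  ∀ p ∈ frontier S, ∃ U : Set (EuclideanSpace ℝ ι), IsOpen U ∧ p ∈ U ∧
    ∃ e : EuclideanSpace ℝ ι, ‖e‖ = 1 ∧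
    ∃ (C : NNReal) (g : EuclideanSpace ℝ ι → ℝ), LipschitzWith C g ∧
      ∀ x ∈ U, (x ∈ S ↔ g (x - (inner ℝ e x : ℝ) • e) ≤ (inner ℝ e x : ℝ))

/-- The point `(x, y)` of `ℝ^m × ℝ^r = ℝ^(m+r)`. -/
def pair {m r : ℕ} (x : EuclideanSpace ℝ (Fin m)) (y : EuclideanSpace ℝ (Fin r)) :
    EuclideanSpace ℝ (Fin m ⊕ Fin r) :=
  WithLp.toLp 2 (Sum.elim x.ofLp y.ofLp)

/-- The product `D × E` as a subset of `ℝ^(m+r)`. -/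
def prodSet {m r : ℕ} (D : Set (EuclideanSpace ℝ (Fin m))) (E : Set (EuclideanSpace ℝ (Fin r))) :
    Set (EuclideanSpace ℝ (Fin m ⊕ Fin r)) :=
  {z | ∃ x ∈ D, ∃ y ∈ E, z = pair x y}

/-- The point `(x, y)` of `D × E`. -/
def pairIn {m r : ℕ} {D : Set (EuclideanSpace ℝ (Fin m))} {E : Set (EuclideanSpace ℝ (Fin r))}
    (x : D) (y : E) : prodSet D E :=
  ⟨pair x.1 y.1, x.1, x.2, y.1, y.2, rfl⟩

theorem continuous_pairIn_left {m r : ℕ} {D : Set (EuclideanSpace ℝ (Fin m))}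
    {E : Set (EuclideanSpace ℝ (Fin r))} (y : E) :
    Continuous (fun x : D => pairIn x y) := by
  refine Continuous.subtype_mk ?_ _
  refine (PiLp.continuous_toLp 2 _).comp (continuous_pi ?_)
  rintro (i | i)
  · exact (continuous_apply i).comp ((PiLp.continuous_ofLp 2 _).comp continuous_subtype_val)
  · exact continuous_const

/-- Lebesgue measure on a subset `Ω` of a Euclidean space. -/
noncomputable def lebesgue {ι : Type} [Fintype ι] (Ω : Set (EuclideanSpace ℝ ι)) : Measure Ω :=
  (volume : Measure (EuclideanSpace ℝ ι)).comap Subtype.val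

/-- The continuous probability densities on `Ω`. -/
def contDensities {ι : Type} [Fintype ι] (Ω : Set (EuclideanSpace ℝ ι)) : Set C(Ω, ℝ) :=
  {ρ | (∫ z, ρ z ∂(lebesgue Ω)) = 1 ∧ ∀ z, 0 ≤ ρ z}

/-- The marginal `m_ρ(y) = ∫_D ρ(x, y) dx`. -/
noncomputable def marginal {m r : ℕ} {D : Set (EuclideanSpace ℝ (Fin m))}
    {E : Set (EuclideanSpace ℝ (Fin r))} (ρ : C(prodSet D E, ℝ)) (y : E) : ℝ :=
  ∫ x, ρ (pairIn x y) ∂(lebesgue D)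

/-- The densities on `D × E` all of whose marginal values are at least `δ`. -/
def boundedBelow {m r : ℕ} (D : Set (EuclideanSpace ℝ (Fin m)))
    (E : Set (EuclideanSpace ℝ (Fin r))) (δ : ℝ) : Set C(prodSet D E, ℝ) :=
  {ρ | ρ ∈ contDensities (prodSet D E) ∧ ∀ y : E, δ ≤ marginal ρ y}

/-- The in-context conditioning operator `(ρ, y) ↦ ρ(· | y) = ρ(·, y) / m_ρ(y)`, with values
in `C(D)`. It is only meant for `m_ρ(y) > 0`, hence for `ρ` in `boundedBelow D E δ`, `δ > 0`. -/
noncomputable def inContext {m r : ℕ} {D : Set (EuclideanSpace ℝ (Fin m))}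
    {E : Set (EuclideanSpace ℝ (Fin r))} (ρ : C(prodSet D E, ℝ)) (y : E) : C(D, ℝ) where
  toFun x := ρ (pairIn x y) / marginal ρ y
  continuous_toFun := (ρ.continuous.comp (continuous_pairIn_left y)).div_const _

/-! ### Neural networks -/

/-- `N : ℝ^ι → ℝ^κ` is a feed-forward neural network with activation `σ`, i.e. an alternating
composition of affine maps and coordinatewise applications of `σ`, beginning and ending with an
affine map; any number of hidden layers, of any widths. -/
inductive IsNeuralNetwork (σ : ℝ → ℝ) {ι : Type} [Fintype ι] :
    {κ : Type} → ((ι → ℝ) → (κ → ℝ)) → Prop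
  | affine {κ : Type} (A : Matrix κ ι ℝ) (b : κ → ℝ) :
      IsNeuralNetwork σ (fun x => A *ᵥ x + b)
  | step {n : ℕ} {κ : Type} (N : (ι → ℝ) → (Fin n → ℝ)) (A : Matrix κ (Fin n) ℝ) (b : κ → ℝ) :
      IsNeuralNetwork σ N → IsNeuralNetwork σ (fun x => A *ᵥ (fun j => σ (N x j)) + b)

/-! ### Neural operators

`C(Ω, α → ℝ)` is the space of continuous functions from `Ω` to `ℝ^α`, with `α` a finite index
type of channels. -/

section Layers

variable {ι ι' α β : Type} [Fintype ι] [Fintype ι'] [Fintype α] [Fintype β]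

/-- Lifting and projection layers: `f ↦ (x ↦ N (x, f x))` with a neural network `N`. -/
def IsPointwiseLayer (σ : ℝ → ℝ) {Ω : Set (EuclideanSpace ℝ ι)}
    (P : C(Ω, α → ℝ) → C(Ω, β → ℝ)) : Prop :=
  ∃ N : (ι ⊕ α → ℝ) → (β → ℝ), IsNeuralNetwork σ N ∧
    ∀ f x, P f x = N (Sum.elim x.1.ofLp (f x))

/-- Hidden layers:
`f ↦ (x ↦ σ (W f(x) + b + ∑ j, ⟨T j f, ψ j⟩ φ j x))`, with `⟨·, ·⟩` the `L²` pairing on `Ω`. -/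
def IsHiddenLayer (σ : ℝ → ℝ) {Ω : Set (EuclideanSpace ℝ ι)}
    (H : C(Ω, α → ℝ) → C(Ω, β → ℝ)) : Prop :=
  ∃ (W : Matrix β α ℝ) (b : β → ℝ) (M : ℕ) (T : Fin M → Matrix α α ℝ)
    (ψ : Fin M → C(Ω, α → ℝ)) (φ : Fin M → C(Ω, β → ℝ)),
    ∀ f x i, H f x i =
      σ ((W *ᵥ f x) i + b i + ∑ j, (∫ z, (T j *ᵥ f z) ⬝ᵥ ψ j z ∂(lebesgue Ω)) * φ j x i)

/-- Hidden layers from functions on `Ω` to functions on another domain `Ω'`: as there is no value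
`f x` at a point `x` of `Ω'`, the local term `W f(x)` is absent. -/
def IsTransferLayer (σ : ℝ → ℝ) {Ω : Set (EuclideanSpace ℝ ι)} {Ω' : Set (EuclideanSpace ℝ ι')}
    (H : C(Ω, α → ℝ) → C(Ω', β → ℝ)) : Prop :=
  ∃ (b : β → ℝ) (M : ℕ) (T : Fin M → Matrix α α ℝ)
    (ψ : Fin M → C(Ω, α → ℝ)) (φ : Fin M → C(Ω', β → ℝ)),
    ∀ f x i, H f x i =
      σ (b i + ∑ j, (∫ z, (T j *ᵥ f z) ⬝ᵥ ψ j z ∂(lebesgue Ω)) * φ j x i)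

/-- Compositions of `n` hidden layers on one domain `Ω`, of any widths. -/
inductive IsHiddenStack (σ : ℝ → ℝ) {Ω : Set (EuclideanSpace ℝ ι)} {d : ℕ} :
    (n : ℕ) → {d' : ℕ} → (C(Ω, Fin d → ℝ) → C(Ω, Fin d' → ℝ)) → Prop
  | nil : IsHiddenStack σ 0 id
  | cons {n d' d'' : ℕ} (F : C(Ω, Fin d → ℝ) → C(Ω, Fin d' → ℝ))
      (H : C(Ω, Fin d' → ℝ) → C(Ω, Fin d'' → ℝ)) :
      IsHiddenStack σ n F → IsHiddenLayer σ H → IsHiddenStack σ (n + 1) (H ∘ F)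

/-- Neural operators of depth `L > 0` from functions on `Ω` to functions on another domain `Ω'`:
maps `Q ∘ H_L ∘ H_{L-1} ∘ ⋯ ∘ H_1 ∘ R` with a lifting layer `R` and hidden layers
`H_1, …, H_{L-1}` on `Ω`, a last hidden layer `H_L` from `Ω` to `Ω'`, and a projection layer `Q`
on `Ω'`. -/
def IsNeuralOperator (σ : ℝ → ℝ) (L : ℕ) {Ω : Set (EuclideanSpace ℝ ι)}
    {Ω' : Set (EuclideanSpace ℝ ι')} (Ψ : C(Ω, α → ℝ) → C(Ω', β → ℝ)) : Prop :=
  ∃ (n d₀ d₁ d₂ : ℕ) (R : C(Ω, α → ℝ) → C(Ω, Fin d₀ → ℝ))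
    (F : C(Ω, Fin d₀ → ℝ) → C(Ω, Fin d₁ → ℝ)) (H : C(Ω, Fin d₁ → ℝ) → C(Ω', Fin d₂ → ℝ))
    (Q : C(Ω', Fin d₂ → ℝ) → C(Ω', β → ℝ)),
    L = n + 1 ∧ IsPointwiseLayer σ R ∧ IsHiddenStack σ n F ∧ IsTransferLayer σ H ∧
      IsPointwiseLayer σ Q ∧ Ψ = Q ∘ H ∘ F ∘ R

end Layers

/-! ### Augmented neural operators -/

/-- Vector-to-function layers `V(z)(x) = h(x) ψ(z)` on `Z ⊆ ℝ^v`, for an input space of functions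
from `Ω` to `ℝ^α`: either `ψ` is a neural network with one output and `h` is in the input space,
or `ψ` is the identity of `ℝ^v` and `h` is a continuous real function. -/
inductive IsVectorToFunctionLayer (σ : ℝ → ℝ) {ι α : Type} [Fintype ι]
    {Ω : Set (EuclideanSpace ℝ ι)} {v : ℕ} {Z : Set (EuclideanSpace ℝ (Fin v))} :
    {γ : Type} → (Z → C(Ω, γ → ℝ)) → Prop
  | network (V : Z → C(Ω, α → ℝ)) (h : C(Ω, α → ℝ)) (ψ : (Fin v → ℝ) → (Unit → ℝ)) :
      IsNeuralNetwork σ ψ → (∀ z x i, V z x i = h x i * ψ z.1.ofLp ()) →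
      IsVectorToFunctionLayer σ V
  | identity (V : Z → C(Ω, Fin v → ℝ)) (h : C(Ω, ℝ)) :
      (∀ z x i, V z x i = h x * z.1 i) → IsVectorToFunctionLayer σ V

/-- The concatenation `f ⊕ g`, `x ↦ (f x, g x)`. -/
def concat {X α γ : Type} [TopologicalSpace X] (f : C(X, α → ℝ)) (g : C(X, γ → ℝ)) :
    C(X, α ⊕ γ → ℝ) where
  toFun x := Sum.elim (f x) (g x)
  continuous_toFun := by
    refine continuous_pi ?_
    rintro (i | i)
    · exact (continuous_apply i).comp f.continuous
    · exact (continuous_apply i).comp g.continuous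

/-- Augmented neural operators of depth `L`: maps `(f, z) ↦ Ψ (f ⊕ V(z))` with a neural operator
`Ψ` of depth `L` and a vector-to-function layer `V`. -/
def IsAugmentedNeuralOperator (σ : ℝ → ℝ) (L : ℕ) {ι ι' α β : Type} [Fintype ι] [Fintype ι']
    [Fintype α] [Fintype β] {Ω : Set (EuclideanSpace ℝ ι)} {Ω' : Set (EuclideanSpace ℝ ι')}
    {v : ℕ} {Z : Set (EuclideanSpace ℝ (Fin v))}
    (Φ : C(Ω, α → ℝ) → Z → C(Ω', β → ℝ)) : Prop :=
  ∃ (γ : Type) (_ : Fintype γ) (V : Z → C(Ω, γ → ℝ)) (Ψ : C(Ω, α ⊕ γ → ℝ) → C(Ω', β → ℝ)),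
    IsVectorToFunctionLayer σ (α := α) V ∧ IsNeuralOperator σ L Ψ ∧
      ∀ f z, Φ f z = Ψ (concat f (V z))

/-- A real function as a function with one channel. -/
def oneChannel {X : Type} [TopologicalSpace X] (f : C(X, ℝ)) : C(X, Unit → ℝ) where
  toFun x := fun _ => f x
  continuous_toFun := continuous_pi fun _ => f.continuous

/-- Augmented neural operators with input space `C(Ω)` and output space `C(Ω')`, i.e. with
one-channel input and output functions. -/
def IsScalarAugmentedNeuralOperator (σ : ℝ → ℝ) (L : ℕ) {ι ι' : Type} [Fintype ι] [Fintype ι']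
    {Ω : Set (EuclideanSpace ℝ ι)} {Ω' : Set (EuclideanSpace ℝ ι')}
    {v : ℕ} {Z : Set (EuclideanSpace ℝ (Fin v))} (Φ : C(Ω, ℝ) → Z → C(Ω', ℝ)) : Prop :=
  ∃ Φ₁ : C(Ω, Unit → ℝ) → Z → C(Ω', Unit → ℝ), IsAugmentedNeuralOperator σ L Φ₁ ∧
    ∀ f z, Φ₁ (oneChannel f) z = oneChannel (Φ f z)

end Conditioning

namespace Conditioning

open Filter Topology

/-! ### Mollification and second-order Taylor expansion of the activation -/

section Smoothing

/-! The conditioning operator is a single continuous function on the compact space `D × K × E`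
(`inContextMap`; the marginals stay above `δ`). So it is enough that scalar functions computable by
neural operators are uniformly dense there, which is a Stone–Weierstrass question.

With the constant layer `V(y) = y`, the integrals of a hidden layer produce every element of
`featureSpan`, the span of the functions `⟨(ρ, y), ψ⟩ φ(x)`. This space contains the constants
because `ρ` has integral one, and it separates points (`featureSpan_separatesPoints`): `x` through
coordinate functions, `ρ` by testing against a difference of densities, `y` through constant test
functions. The Lipschitz boundaries enter only here: they make Lebesgue measure on `D × E` positive
on nonempty open sets.

For a non-affine `σ`, possibly a polynomial, one layer of `σ` need not be dense, so `deepSpan`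
iterates "apply `σ`, take the span". Second differences of a mollified `σ` yield squares in the
closure of the next level (`sq_mem_of_comp_mem`). Polarization turns squares into products, so the
union of the closures is an algebra and Stone–Weierstrass applies
(`exists_mem_deepSpan_norm_sub_lt`). The first `σ` is the transfer layer, and all later ones sit in
the projection network, so operator depth one suffices. -/

theorem affine_of_deriv_deriv_eq_zero {g : ℝ → ℝ} (hg : ContDiff ℝ 2 g)
    (h : ∀ t, deriv (deriv g) t = 0) : ∀ t, g t = g 0 + t * (g 1 - g 0) := by
  have hd : Differentiable ℝ g := hg.differentiable (by norm_num)
  have hd' : Differentiable ℝ (deriv g) := by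
    have : ContDiff ℝ 1 (deriv g) := ContDiff.deriv' (n := 1) (by rw [one_add_one_eq_two]; exact hg)
    exact this.differentiable (by norm_num)
  have h1 : ∀ t, deriv g t = deriv g 0 := fun t => is_const_of_deriv_eq_zero hd' h t 0
  have h2 : ∀ t, g t - deriv g 0 * t = g 0 - deriv g 0 * 0 := fun t => by
    refine is_const_of_deriv_eq_zero (f := fun t => g t - deriv g 0 * t) (by fun_prop) ?_ t 0
    intro s
    have : HasDerivAt (fun t => g t - deriv g 0 * t) (deriv g s - deriv g 0 * 1) s :=
      (hd s).hasDerivAt.sub ((hasDerivAt_id s).const_mul _)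
    rw [this.deriv, h1 s]; ring
  intro t
  have h3 := h2 1
  have h4 := h2 t
  linear_combination h4 - t * h3

/-- A continuous function that is not affine has a mollification that is not affine. -/
theorem exists_mollification_deriv_deriv_ne_zero {σ : ℝ → ℝ} (hσ : Continuous σ)
    (hna : ¬ ∃ a b : ℝ, ∀ t, σ t = a * t + b) :
    ∃ φ : ℝ → ℝ, Continuous φ ∧ HasCompactSupport φ ∧
      ContDiff ℝ 2 (fun t => ∫ s, φ s * σ (t - s)) ∧
      ∃ t₀, deriv (deriv (fun t => ∫ s, φ s * σ (t - s))) t₀ ≠ 0 := by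
  by_contra! hcon
  let φ : ℕ → ContDiffBump (0 : ℝ) := fun n =>
    ⟨1 / (2 * ((n : ℝ) + 1)), 1 / ((n : ℝ) + 1), by positivity, by
      apply one_div_lt_one_div_of_lt <;> linarith [(n.cast_nonneg : (0 : ℝ) ≤ n)]⟩
  have hφ : Tendsto (fun n => (φ n).rOut) atTop (𝓝 0) := tendsto_one_div_add_atTop_nhds_zero_nat
  have hsm : ∀ n, ContDiff ℝ 2 (fun t => ∫ s, (φ n).normed volume s * σ (t - s)) := fun n => by
    have := (φ n).hasCompactSupport_normed (μ := volume) |>.contDiff_convolution_left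
      (ContinuousLinearMap.lsmul ℝ ℝ) (n := 2) (φ n).contDiff_normed
      (hσ.locallyIntegrable (μ := volume))
    exact this
  have hlim : ∀ t, Tendsto (fun n => ∫ s, (φ n).normed volume s * σ (t - s)) atTop (𝓝 (σ t)) :=
    fun t => ContDiffBump.convolution_tendsto_right_of_continuous (μ := volume) hφ hσ t
  have haff : ∀ t, σ t = σ 0 + t * (σ 1 - σ 0) := fun t => by
    -- If every mollification is affine, the relation `g t = g 0 + t (g 1 - g 0)` holds for each of
    -- them and survives the pointwise limit.
    refine tendsto_nhds_unique (hlim t) ?_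
    refine ((hlim 0).add (((hlim 1).sub (hlim 0)).const_mul t)).congr fun n => ?_
    exact (affine_of_deriv_deriv_eq_zero (hsm n)
      (hcon _ (φ n).continuous_normed (φ n).hasCompactSupport_normed (hsm n)) t).symm
  exact hna ⟨σ 1 - σ 0, σ 0, fun t => by rw [haff t]; ring⟩

/-- The odd Taylor terms at `t₀ + u` and `t₀ - u` cancel; each expansion contributes half of the
error `η u²`. -/
theorem second_order_remainder {g : ℝ → ℝ} (hg : ContDiff ℝ 2 g) (t₀ : ℝ) {η : ℝ} (hη : 0 < η) :
    ∃ d > 0, ∀ u : ℝ, |u| < d →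
      |g (t₀ + u) + g (t₀ - u) - 2 * g t₀ - deriv (deriv g) t₀ * u ^ 2| ≤ η * u ^ 2 := by
  have h := taylor_isLittleO_univ (x₀ := t₀) (n := 2) (by exact_mod_cast hg)
  have h' := h.bound (half_pos hη)
  obtain ⟨d, hd, hb⟩ := Metric.eventually_nhds_iff.1 h'
  refine ⟨d, hd, fun u hu => ?_⟩
  have h1 := hb (y := t₀ + u) (by simpa using hu)
  have h2 := hb (y := t₀ - u) (by simpa using hu)
  simp only [taylor_within_apply, Finset.sum_range_succ, Finset.sum_range_zero,
    iteratedDerivWithin_univ, iteratedDeriv_succ, iteratedDeriv_zero, Real.norm_eq_abs,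
    smul_eq_mul, Nat.factorial] at h1 h2
  norm_num at h1 h2
  rw [abs_le] at h1 h2 ⊢
  constructor <;> nlinarith [h1.1, h1.2, h2.1, h2.2]

end Smoothing

/-! ### Squares in closed subspaces of `C(X)` -/

section Operating

variable {X : Type*} [TopologicalSpace X] [CompactSpace X]

theorem mem_of_forall_norm_sub_le {A : Submodule ℝ C(X, ℝ)} (hA : IsClosed (A : Set C(X, ℝ)))
    {f : C(X, ℝ)} (h : ∀ ε > 0, ∃ a ∈ A, ‖f - a‖ ≤ ε) : f ∈ A := by
  rw [← SetLike.mem_coe, ← hA.closure_eq, Metric.mem_closure_iff]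
  intro ε hε
  obtain ⟨a, ha, h⟩ := h (ε / 2) (half_pos hε)
  exact ⟨a, ha, by rw [dist_eq_norm]; linarith⟩

/-- The second difference of `g` at `t₀` with step `k f`, divided by `g''(t₀) k²`, tends uniformly
to `f ^ 2` as `k → 0`. -/
theorem sq_mem_of_contDiff_comp_mem {A : Submodule ℝ C(X, ℝ)} (hA : IsClosed (A : Set C(X, ℝ)))
    (f : C(X, ℝ)) (g : C(ℝ, ℝ)) (hg : ContDiff ℝ 2 g) {t₀ : ℝ} (ht : deriv (deriv g) t₀ ≠ 0)
    (h : ∀ w b : ℝ, g.comp (w • f + ContinuousMap.const X b) ∈ A) : f ^ 2 ∈ A := by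
  refine mem_of_forall_norm_sub_le hA fun ε hε => ?_
  set c := deriv (deriv g) t₀ with hc
  have hB : 0 < ‖f‖ + 1 := by positivity
  -- This `η` makes the remainder `η (k f)²` at most `ε` after division by `|c| k²`; `k` below keeps
  -- `|k f| < d`.
  obtain ⟨d, hd, hb⟩ := second_order_remainder hg t₀
    (η := ε * |c| / (‖f‖ + 1) ^ 2) (by positivity)
  set k := d / (2 * (‖f‖ + 1)) with hk
  have hk0 : 0 < k := by positivity
  refine ⟨(c * k ^ 2)⁻¹ • (g.comp (k • f + ContinuousMap.const X t₀) +
    g.comp ((-k) • f + ContinuousMap.const X t₀) -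
    (2 : ℝ) • g.comp ((0 : ℝ) • f + ContinuousMap.const X t₀)),
    A.smul_mem _ (A.sub_mem (A.add_mem (h _ _) (h _ _)) (A.smul_mem _ (h _ _))), ?_⟩
  rw [ContinuousMap.norm_le _ hε.le]
  intro x
  have hfx : |f x| ≤ ‖f‖ := f.norm_coe_le_norm x
  have hu : |k * f x| < d := by
    rw [abs_mul, abs_of_pos hk0]
    have : k * (‖f‖ + 1) = d / 2 := by rw [hk]; field_simp
    nlinarith
  have h1 := hb _ hu
  simp only [ContinuousMap.sub_apply, ContinuousMap.pow_apply, ContinuousMap.smul_apply,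
    ContinuousMap.add_apply, ContinuousMap.comp_apply, ContinuousMap.const_apply, smul_eq_mul,
    Real.norm_eq_abs, zero_mul, zero_add]
  have e1 : k * f x + t₀ = t₀ + k * f x := by ring
  have e2 : -k * f x + t₀ = t₀ - k * f x := by ring
  rw [e1, e2]
  set R := g (t₀ + k * f x) + g (t₀ - k * f x) - 2 * g t₀ with hR
  have e3 : f x ^ 2 - (c * k ^ 2)⁻¹ * R = -((c * k ^ 2)⁻¹ * (R - c * (k * f x) ^ 2)) := by
    field_simp; ring
  rw [e3, abs_neg, abs_mul, abs_inv, abs_mul, abs_of_pos (pow_pos hk0 2)]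
  have hcp : 0 < |c| := abs_pos.2 ht
  rw [inv_mul_le_iff₀ (by positivity)]
  refine h1.trans ?_
  have hsq : f x ^ 2 ≤ (‖f‖ + 1) ^ 2 := by
    rw [← sq_abs]; exact pow_le_pow_left₀ (abs_nonneg _) (by linarith) 2
  calc ε * |c| / (‖f‖ + 1) ^ 2 * (k * f x) ^ 2
      = (ε * |c| * k ^ 2) * (f x ^ 2 / (‖f‖ + 1) ^ 2) := by ring
    _ ≤ (ε * |c| * k ^ 2) * 1 := by
        gcongr
        exact (div_le_one (by positivity)).2 hsq
    _ = |c| * k ^ 2 * ε := by ring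

/-- `g ∘ f` is the `C(X)`-valued integral of `φ s • σ ∘ (f - s)`, whose integrand lies in `A`. As
`A` is complete, the integral can be taken inside it. -/
theorem mollification_comp_mem {A : Submodule ℝ C(X, ℝ)} (hA : IsClosed (A : Set C(X, ℝ)))
    (σ : C(ℝ, ℝ)) {φ : ℝ → ℝ} (hφ : Continuous φ) (hφc : HasCompactSupport φ) (g : C(ℝ, ℝ))
    (hg : ∀ t, g t = ∫ s, φ s * σ (t - s)) (f : C(X, ℝ))
    (h : ∀ b : ℝ, σ.comp (f + ContinuousMap.const X b) ∈ A) : g.comp f ∈ A := by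
  let F : ℝ → C(X, ℝ) := fun s => φ s • σ.comp (f + ContinuousMap.const X (-s))
  have hFc : Continuous F := by
    refine hφ.smul ?_
    refine (ContinuousMap.continuous_postcomp σ).comp ?_
    exact continuous_const.add (ContinuousMap.continuous_const'.comp continuous_neg)
  have hFs : HasCompactSupport F := hφc.smul_right
  have hFi : Integrable F := hFc.integrable_of_hasCompactSupport hFs
  have hAc : CompleteSpace A := hA.completeSpace_coe
  let G : ℝ → A := fun s => ⟨F s, A.smul_mem _ (h _)⟩
  have : g.comp f = ∫ s, F s := by
    ext x
    rw [ContinuousMap.integral_apply hFi, ContinuousMap.comp_apply, hg]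
    simp [F, sub_eq_add_neg]
  rw [this]
  have hGi : Integrable G := by
    have hGc : Continuous G := hFc.subtype_mk _
    refine hGc.integrable_of_hasCompactSupport ?_
    exact hFs.mono fun s hs => by
      contrapose! hs
      simpa [G, Subtype.ext_iff] using hs
  have := ContinuousLinearMap.integral_comp_comm (𝕜 := ℝ) (Fₗ := C(X, ℝ)) A.subtypeL hGi
  change ∫ s, F s = _ at this
  rw [this]
  exact Subtype.mem _

/-- If a closed subspace of `C(X)` contains `σ (w f + b)` for all `w`, `b`, with `σ` not affine,
then it contains `f ^ 2`. -/
theorem sq_mem_of_comp_mem {A : Submodule ℝ C(X, ℝ)} (hA : IsClosed (A : Set C(X, ℝ)))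
    (σ : C(ℝ, ℝ)) (hna : ¬ ∃ a b : ℝ, ∀ t, σ t = a * t + b) (f : C(X, ℝ))
    (h : ∀ w b : ℝ, σ.comp (w • f + ContinuousMap.const X b) ∈ A) : f ^ 2 ∈ A := by
  obtain ⟨φ, hφ, hφc, hsm, t₀, ht⟩ := exists_mollification_deriv_deriv_ne_zero σ.continuous hna
  let g : C(ℝ, ℝ) := ⟨_, hsm.continuous⟩
  refine sq_mem_of_contDiff_comp_mem hA f g hsm ht fun w b => ?_
  refine mollification_comp_mem hA σ hφ hφc g (fun _ => rfl) _ fun b' => ?_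
  convert h w (b + b') using 2
  ext x
  simp [add_assoc]

end Operating

/-! ### Density of iterated spans, and their realization by networks -/

section DeepSpan

variable {X : Type*} [TopologicalSpace X]

/-- Iterating `S ↦ span {σ ∘ f | f ∈ S}`. -/
def deepSpan (σ : C(ℝ, ℝ)) (S : Submodule ℝ C(X, ℝ)) : ℕ → Submodule ℝ C(X, ℝ)
  | 0 => S
  | n + 1 => Submodule.span ℝ ((fun f => σ.comp f) '' (deepSpan σ S n : Set C(X, ℝ)))

theorem comp_mem_deepSpan (σ : C(ℝ, ℝ)) (S : Submodule ℝ C(X, ℝ)) {n : ℕ} {f : C(X, ℝ)}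
    (hf : f ∈ deepSpan σ S n) : σ.comp f ∈ deepSpan σ S (n + 1) :=
  Submodule.subset_span ⟨f, hf, rfl⟩

/-- A constant at a point where `σ` does not vanish, once rescaled, gives all constants at the next
level. Hence biases come for free. -/
theorem const_mem_deepSpan {σ : C(ℝ, ℝ)} (hσ : ∃ t, σ t ≠ 0) {S : Submodule ℝ C(X, ℝ)}
    (hS : 1 ∈ S) (n : ℕ) (b : ℝ) : ContinuousMap.const X b ∈ deepSpan σ S n := by
  induction n generalizing b with
  | zero =>
    change _ ∈ S
    convert S.smul_mem b hS
    ext x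
    simp
  | succ n ih =>
    obtain ⟨t, ht⟩ := hσ
    convert Submodule.smul_mem _ (b / σ t) (comp_mem_deepSpan σ S (ih t))
    ext; simp [ht]

variable [CompactSpace X]

theorem sq_mem_closure_deepSpan {σ : C(ℝ, ℝ)} (hna : ¬ ∃ a b : ℝ, ∀ t, σ t = a * t + b)
    (hσ : ∃ t, σ t ≠ 0) {S : Submodule ℝ C(X, ℝ)} (hS : 1 ∈ S) {n : ℕ} {f : C(X, ℝ)}
    (hf : f ∈ deepSpan σ S n) : f ^ 2 ∈ (deepSpan σ S (n + 1)).topologicalClosure := by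
  refine sq_mem_of_comp_mem (Submodule.isClosed_topologicalClosure _) σ hna f fun w b => ?_
  refine Submodule.le_topologicalClosure _ (comp_mem_deepSpan σ S ?_)
  exact Submodule.add_mem _ (Submodule.smul_mem _ _ hf) (const_mem_deepSpan hσ hS n b)

/-- `f = ((f + 1)² - f² - 1) / 2`. The levels themselves need not be nested, but their closures are.
-/
theorem mem_closure_deepSpan_succ {σ : C(ℝ, ℝ)} (hna : ¬ ∃ a b : ℝ, ∀ t, σ t = a * t + b)
    (hσ : ∃ t, σ t ≠ 0) {S : Submodule ℝ C(X, ℝ)} (hS : 1 ∈ S) {n : ℕ} {f : C(X, ℝ)}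
    (hf : f ∈ deepSpan σ S n) : f ∈ (deepSpan σ S (n + 1)).topologicalClosure := by
  have h1 := sq_mem_closure_deepSpan hna hσ hS
    (Submodule.add_mem _ hf (const_mem_deepSpan hσ hS n 1))
  have h2 := sq_mem_closure_deepSpan hna hσ hS hf
  have h3 := Submodule.le_topologicalClosure _ (const_mem_deepSpan (X := X) hσ hS (n + 1) 1)
  convert Submodule.smul_mem _ (1 / 2 : ℝ) (Submodule.sub_mem _ (Submodule.sub_mem _ h1 h2) h3)
  ext x
  simp
  ring

theorem closure_deepSpan_mono {σ : C(ℝ, ℝ)} (hna : ¬ ∃ a b : ℝ, ∀ t, σ t = a * t + b)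
    (hσ : ∃ t, σ t ≠ 0) {S : Submodule ℝ C(X, ℝ)} (hS : 1 ∈ S) :
    Monotone fun n => (deepSpan σ S n).topologicalClosure :=
  monotone_nat_of_le_succ fun _ => Submodule.topologicalClosure_minimal _
    (fun _ hf => mem_closure_deepSpan_succ hna hσ hS hf) (Submodule.isClosed_topologicalClosure _)

/-- Deep spans of a point-separating space of functions that contains the constants are dense. -/
theorem exists_mem_deepSpan_norm_sub_lt {σ : C(ℝ, ℝ)} (hna : ¬ ∃ a b : ℝ, ∀ t, σ t = a * t + b)
    {S : Submodule ℝ C(X, ℝ)} (hS : 1 ∈ S) (hsep : ∀ x y : X, x ≠ y → ∃ f ∈ S, f x ≠ f y)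
    (f : C(X, ℝ)) {ε : ℝ} (hε : 0 < ε) : ∃ n, ∃ g ∈ deepSpan σ S (n + 1), ‖f - g‖ < ε := by
  have hσ : ∃ t, σ t ≠ 0 := by
    by_contra! h
    exact hna ⟨0, 0, fun t => by simp [h t]⟩
  have hmono := closure_deepSpan_mono hna hσ hS
  let B : Submodule ℝ C(X, ℝ) := ⨆ n, (deepSpan σ S n).topologicalClosure
  have hB : ∀ {f}, f ∈ B ↔ ∃ n, f ∈ (deepSpan σ S n).topologicalClosure := fun {f} =>
    Submodule.mem_iSup_of_directed _ hmono.directed_le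
  have hsq : ∀ {f}, f ∈ B → f ^ 2 ∈ B := fun {f} hf => by
    obtain ⟨n, hn⟩ := hB.1 hf
    refine hB.2 ⟨n + 1, ?_⟩
    have := map_mem_closure (continuous_pow 2) hn fun g hg => sq_mem_closure_deepSpan hna hσ hS hg
    rw [← SetLike.mem_coe, ← (Submodule.isClosed_topologicalClosure _).closure_eq]
    exact this
  have hmem : ∀ {f}, f ∈ S → f ∈ B := fun {f} hf =>
    hB.2 ⟨0, Submodule.le_topologicalClosure _ hf⟩
  -- Polarization: `f g = ((f + g)² - f² - g²) / 2`.
  let 𝒜 : Subalgebra ℝ C(X, ℝ) := B.toSubalgebra (hmem hS) fun f g hf hg => by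
    convert B.smul_mem (1 / 2 : ℝ)
      (B.sub_mem (B.sub_mem (hsq (B.add_mem hf hg)) (hsq hf)) (hsq hg))
    ext x
    simp
    ring
  have hsep' : 𝒜.SeparatesPoints := fun x y hxy => by
    obtain ⟨f, hf, h⟩ := hsep x y hxy
    exact ⟨f, ⟨f, hmem hf, rfl⟩, h⟩
  have htop := ContinuousMap.subalgebra_topologicalClosure_eq_top_of_separatesPoints 𝒜 hsep'
  have hfc : f ∈ closure (𝒜 : Set C(X, ℝ)) := by
    rw [← Subalgebra.topologicalClosure_coe, htop]
    trivial
  obtain ⟨b, hb, hfb⟩ := Metric.mem_closure_iff.1 hfc (ε / 2) (half_pos hε)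
  obtain ⟨n, hn⟩ := hB.1 (show b ∈ B from hb)
  -- Passing to level `n + 1` guarantees at least one application of `σ`, the one that the transfer
  -- layer performs.
  obtain ⟨g, hg, hbg⟩ := Metric.mem_closure_iff.1 (hmono n.le_succ hn) (ε / 2) (half_pos hε)
  refine ⟨n, g, hg, ?_⟩
  rw [← dist_eq_norm]
  linarith [dist_triangle f b g]

theorem exists_sum_of_mem_deepSpan_succ {X : Type*} [TopologicalSpace X] {σ : C(ℝ, ℝ)}
    {S : Submodule ℝ C(X, ℝ)} {n : ℕ} {f : C(X, ℝ)} (hf : f ∈ deepSpan σ S (n + 1)) :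
    ∃ (k : ℕ) (a : Fin k → ℝ) (s : Fin k → C(X, ℝ)), (∀ i, s i ∈ deepSpan σ S n) ∧
      ∀ x, f x = ∑ i, a i * σ (s i x) := by
  obtain ⟨k, a, s, rfl⟩ := Submodule.mem_span_set'.1 hf
  choose t ht ht' using fun i => (s i).2
  refine ⟨k, a, t, ht, fun x => ?_⟩
  simp [← ht']

/-- Finite families in a deep span are neural networks in the values `σ (s i)`, `s i ∈ S`. -/
theorem exists_network_of_mem_deepSpan {X : Type*} [TopologicalSpace X] {σ : C(ℝ, ℝ)}
    {S : Submodule ℝ C(X, ℝ)} (ι : Type) [Fintype ι] (n : ℕ) {κ : Type} [Fintype κ]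
    (f : κ → C(X, ℝ)) (hf : ∀ k, f k ∈ deepSpan σ S (n + 1)) :
    ∃ (d : ℕ) (s : Fin d → C(X, ℝ)) (N : (ι ⊕ Fin d → ℝ) → (κ → ℝ)), (∀ i, s i ∈ S) ∧
      IsNeuralNetwork σ N ∧ ∀ u x k, f k x = N (Sum.elim u fun i => σ (s i x)) k := by
  classical
  choose l a s hs hsum using fun k => exists_sum_of_mem_deepSpan_succ (hf k)
  let e := Fintype.equivFin (Σ k, Fin (l k))
  let t : Fin (Fintype.card (Σ k, Fin (l k))) → C(X, ℝ) := fun j => s (e.symm j).1 (e.symm j).2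
  -- The summands of all outputs are listed in one layer; row `k` keeps only those belonging to `f
  -- k`.
  let A : Matrix κ (Fin (Fintype.card (Σ k, Fin (l k)))) ℝ :=
    fun k j => if (e.symm j).1 = k then a (e.symm j).1 (e.symm j).2 else 0
  have he : ∀ x k p, A k (e p) * σ (t (e p) x) =
      if p.1 = k then a p.1 p.2 * σ (s p.1 p.2 x) else 0 := fun x k p => by
    simp only [A, t, ite_mul, zero_mul]
    rw [Equiv.symm_apply_apply]
  have hA : ∀ x k, f k x = (A *ᵥ fun j => σ (t j x)) k := fun x k => by
    rw [hsum, Matrix.mulVec, dotProduct, ← e.sum_comp, Fintype.sum_sigma, Finset.sum_eq_single k]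
    · simp only [he, if_true]
    · intro k' _ hk'
      simp only [he, if_neg hk', Finset.sum_const_zero]
    · simp
  have ht : ∀ j, t j ∈ deepSpan σ S n := fun j => hs _ _
  cases n with
  | zero =>
    -- The `σ` of the lowest level is already in the inputs, so an affine map remains; the zero
    -- block ignores `u`.
    refine ⟨_, t, _, ht, .affine (Matrix.fromCols 0 A) 0, fun u x k => ?_⟩
    rw [hA, Matrix.fromCols_mulVec]
    simp [Function.comp_def]
  | succ n =>
    obtain ⟨d, s', N, hs', hN, h⟩ := exists_network_of_mem_deepSpan ι n t ht
    refine ⟨d, s', _, hs', .step N A 0 hN, fun u x k => ?_⟩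
    rw [hA]
    simp only [h u x, add_zero]

end DeepSpan

/-! ### Lipschitz domains, products and Lebesgue measure -/

section Geometry

/-- Moving a boundary point of `S` along `e` fixes its projection and raises its height, so it goes
strictly above the graph, hence into the interior. -/
theorem HasLipschitzBoundary.subset_closure_interior {ι : Type} [Fintype ι]
    {S : Set (EuclideanSpace ℝ ι)} (h : HasLipschitzBoundary S) : S ⊆ closure (interior S) := by
  intro p hp
  by_cases hpi : p ∈ interior S
  · exact subset_closure hpi
  obtain ⟨U, hU, hpU, e, he, C, g, hg, hS⟩ := h p ⟨subset_closure hp, hpi⟩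
  have hcont : Continuous fun x : EuclideanSpace ℝ ι =>
      g (x - (inner ℝ e x : ℝ) • e) := hg.continuous.comp (by fun_prop)
  let V : Set (EuclideanSpace ℝ ι) :=
    U ∩ {x | g (x - (inner ℝ e x : ℝ) • e) < (inner ℝ e x : ℝ)}
  have hV : IsOpen V := hU.inter (isOpen_lt hcont (by fun_prop))
  have hVS : V ⊆ interior S :=
    interior_maximal (fun x hx => (hS x hx.1).2 (le_of_lt hx.2)) hV
  have hlim : Tendsto (fun t : ℝ => p + t • e) (𝓝[>] 0) (𝓝 p) := by
    have : Continuous fun t : ℝ => p + t • e := by fun_prop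
    simpa using (this.tendsto 0).mono_left nhdsWithin_le_nhds
  refine mem_closure_of_tendsto hlim ?_
  filter_upwards [hlim.eventually (hU.mem_nhds hpU), self_mem_nhdsWithin] with t ht ht0
  refine hVS ⟨ht, ?_⟩
  have hin : (inner ℝ e (p + t • e) : ℝ) = inner ℝ e p + t := by
    rw [inner_add_right, inner_smul_right, real_inner_self_eq_norm_sq, he]; ring
  have hpr : p + t • e - (inner ℝ e p + t : ℝ) • e = p - (inner ℝ e p : ℝ) • e := by
    rw [add_smul]; abel
  change g (p + t • e - (inner ℝ e (p + t • e) : ℝ) • e) < _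
  rw [hin, hpr]
  have := (hS p hpU).1 hp
  have ht0' : (0 : ℝ) < t := ht0
  linarith

variable {m r : ℕ} {D : Set (EuclideanSpace ℝ (Fin m))} {E : Set (EuclideanSpace ℝ (Fin r))}

theorem continuous_pair : Continuous fun q : EuclideanSpace ℝ (Fin m) × EuclideanSpace ℝ (Fin r) =>
    pair q.1 q.2 := by
  refine (PiLp.continuous_toLp 2 _).comp (continuous_pi ?_)
  rintro (i | i)
  · exact (continuous_apply i).comp ((PiLp.continuous_ofLp 2 _).comp continuous_fst)
  · exact (continuous_apply i).comp ((PiLp.continuous_ofLp 2 _).comp continuous_snd)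

theorem continuous_pairIn : Continuous fun q : D × E => pairIn q.1 q.2 := by
  refine Continuous.subtype_mk ?_ _
  exact continuous_pair.comp (continuous_subtype_val.prodMap continuous_subtype_val)

theorem pairIn_surjective : Function.Surjective fun q : D × E => pairIn q.1 q.2 := by
  rintro ⟨_, x, hx, y, hy, rfl⟩
  exact ⟨(⟨x, hx⟩, ⟨y, hy⟩), rfl⟩

instance compactSpace_prodSet [CompactSpace D] [CompactSpace E] : CompactSpace (prodSet D E) :=
  pairIn_surjective.compactSpace continuous_pairIn

theorem prodSet_interior_subset : prodSet (interior D) (interior E) ⊆ interior (prodSet D E) := by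
  refine interior_maximal ?_ ?_
  · rintro _ ⟨x, hx, y, hy, rfl⟩
    exact ⟨x, interior_subset hx, y, interior_subset hy, rfl⟩
  · have h1 : Continuous fun z : EuclideanSpace ℝ (Fin m ⊕ Fin r) =>
        (WithLp.toLp 2 fun i => z (Sum.inl i) : EuclideanSpace ℝ (Fin m)) :=
      (PiLp.continuous_toLp 2 _).comp (continuous_pi fun i => by fun_prop)
    have h2 : Continuous fun z : EuclideanSpace ℝ (Fin m ⊕ Fin r) =>
        (WithLp.toLp 2 fun i => z (Sum.inr i) : EuclideanSpace ℝ (Fin r)) :=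
      (PiLp.continuous_toLp 2 _).comp (continuous_pi fun i => by fun_prop)
    convert (isOpen_interior.preimage h1).inter (isOpen_interior.preimage h2) using 1
    ext z
    constructor
    · rintro ⟨x, hx, y, hy, rfl⟩
      exact ⟨hx, hy⟩
    · rintro ⟨hx, hy⟩
      refine ⟨_, hx, _, hy, ?_⟩
      ext (i | i) <;> rfl

theorem prodSet_subset_closure_interior (hD : D ⊆ closure (interior D))
    (hE : E ⊆ closure (interior E)) : prodSet D E ⊆ closure (interior (prodSet D E)) := by
  rintro _ ⟨x, hx, y, hy, rfl⟩
  refine closure_mono prodSet_interior_subset ?_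
  have h : (x, y) ∈ closure (interior D ×ˢ interior E) := by
    rw [closure_prod_eq]; exact ⟨hD hx, hE hy⟩
  exact map_mem_closure (f := fun q : _ × _ => pair q.1 q.2) continuous_pair h
    fun q hq => ⟨q.1, hq.1, q.2, hq.2, rfl⟩

variable {ι : Type} [Fintype ι] {Ω : Set (EuclideanSpace ℝ ι)} [CompactSpace Ω]

theorem measurableEmbedding_subtype_val_of_compactSpace :
    MeasurableEmbedding (Subtype.val : Ω → EuclideanSpace ℝ ι) :=
  MeasurableEmbedding.subtype_coe (isCompact_iff_compactSpace.2 ‹_›).measurableSet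

instance isFiniteMeasure_lebesgue : IsFiniteMeasure (lebesgue Ω) := by
  refine ⟨?_⟩
  rw [lebesgue, measurableEmbedding_subtype_val_of_compactSpace.comap_apply, Set.image_univ,
    Subtype.range_coe]
  exact (isCompact_iff_compactSpace.2 ‹_›).measure_lt_top

theorem isOpenPosMeasure_lebesgue (h : Ω ⊆ closure (interior Ω)) :
    (lebesgue Ω).IsOpenPosMeasure := by
  refine ⟨fun U hU ⟨p, hp⟩ => ?_⟩
  obtain ⟨V, hV, rfl⟩ := isOpen_induced_iff.1 hU
  rw [lebesgue, measurableEmbedding_subtype_val_of_compactSpace.comap_apply,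
    Subtype.image_preimage_coe]
  obtain ⟨q, hq⟩ := mem_closure_iff.1 (h p.2) V hV hp
  have hpos : 0 < volume (V ∩ interior Ω) := (hV.inter isOpen_interior).measure_pos _ ⟨q, hq⟩
  refine (hpos.trans_le (measure_mono ?_)).ne'
  rintro z ⟨h1, h2⟩
  exact ⟨interior_subset h2, h1⟩

theorem integrable_lebesgue (f : C(Ω, ℝ)) : Integrable f (lebesgue Ω) := by
  have := f.continuous.integrable_of_hasCompactSupport (μ := lebesgue Ω)
    (HasCompactSupport.of_compactSpace f)
  exact this

/-- Subtracting the two sides gives `∫ (ρ₁ - ρ₂)² = 0`, which is impossible for a nonzero continuous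
function when open sets have positive measure. -/
theorem eq_of_integral_mul_sub_eq (h : Ω ⊆ closure (interior Ω)) {ρ₁ ρ₂ : C(Ω, ℝ)}
    (heq : ∫ z, ρ₁ z * (ρ₁ - ρ₂) z ∂(lebesgue Ω) = ∫ z, ρ₂ z * (ρ₁ - ρ₂) z ∂(lebesgue Ω)) :
    ρ₁ = ρ₂ := by
  have := isOpenPosMeasure_lebesgue h
  by_contra hne
  have hx : ∃ z, ρ₁ z ≠ ρ₂ z := by
    by_contra! hc
    exact hne (ContinuousMap.ext hc)
  obtain ⟨z, hz⟩ := hx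
  have hpos : 0 < ∫ z, ((ρ₁ - ρ₂) * (ρ₁ - ρ₂)) z ∂(lebesgue Ω) := by
    refine Continuous.integral_pos_of_hasCompactSupport_nonneg_nonzero (x := z)
      (ContinuousMap.continuous _) (HasCompactSupport.of_compactSpace _) ?_ ?_
    · intro w; simpa using mul_self_nonneg _
    · simpa [sub_eq_zero] using hz
  have hsub := integral_sub (integrable_lebesgue (ρ₁ * (ρ₁ - ρ₂)))
    (integrable_lebesgue (ρ₂ * (ρ₁ - ρ₂)))
  simp only [ContinuousMap.mul_apply] at hsub hpos
  rw [heq, sub_self] at hsub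
  simp only [← sub_mul] at hsub
  exact hpos.ne' hsub

/-- Integration against Lebesgue measure is continuous in a continuous parameter. -/
theorem continuous_integral_lebesgue {Y : Type*} [TopologicalSpace Y] {F : Y → Ω → ℝ}
    (hF : Continuous (Function.uncurry F)) : Continuous fun y => ∫ z, F y z ∂(lebesgue Ω) := by
  let G : C(Y, C(Ω, ℝ)) := ContinuousMap.curry ⟨_, hF⟩
  have h : Continuous fun f : C(Ω, ℝ) => ∫ z, f z ∂(lebesgue Ω) := by
    have : LipschitzWith (lebesgue Ω Set.univ).toNNReal fun f : C(Ω, ℝ) =>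
        ∫ z, f z ∂(lebesgue Ω) := by
      refine LipschitzWith.of_dist_le_mul fun f g => ?_
      rw [dist_eq_norm, ← integral_sub (integrable_lebesgue f) (integrable_lebesgue g),
        dist_eq_norm, mul_comm]
      exact norm_integral_le_of_norm_le_const (ae_of_all _ (f - g).norm_coe_le_norm)
    exact this.continuous
  exact h.comp G.continuous

end Geometry

/-! ### Neural operators of depth one -/

section Operator

theorem IsNeuralNetwork.continuous {σ : ℝ → ℝ} (hσ : Continuous σ) {ι κ : Type} [Fintype ι]
    {N : (ι → ℝ) → (κ → ℝ)} (h : IsNeuralNetwork σ N) : Continuous N := by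
  induction h with
  | affine A b => exact (Continuous.matrix_mulVec continuous_const continuous_id).add_const b
  | step N A b _ ih =>
    exact (Continuous.matrix_mulVec continuous_const (by fun_prop)).add_const b

variable {m r : ℕ} {D : Set (EuclideanSpace ℝ (Fin m))} {E : Set (EuclideanSpace ℝ (Fin r))}

/-- The input `z ↦ (ρ z, y)` of the neural operator. -/
def augmentedInput (ρ : C(prodSet D E, ℝ)) (y : E) : C(prodSet D E, Unit ⊕ Fin r → ℝ) :=
  concat (oneChannel ρ) (ContinuousMap.const _ y.1.ofLp)

theorem continuous_augmentedInput [CompactSpace D] [CompactSpace E] :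
    Continuous fun q : (C(prodSet D E, ℝ) × E) × prodSet D E =>
      augmentedInput q.1.1 q.1.2 q.2 := by
  refine continuous_pi ?_
  rintro (i | i)
  · change Continuous fun q : (C(prodSet D E, ℝ) × E) × prodSet D E => q.1.1 q.2
    fun_prop
  · change Continuous fun q : (C(prodSet D E, ℝ) × E) × prodSet D E => q.1.2.1.ofLp i
    fun_prop

/-- The linear functional `(ρ, y) ↦ ∫ ⟨(ρ z, y), ψ z⟩ dz`. -/
noncomputable def pairing (ψ : C(prodSet D E, Unit ⊕ Fin r → ℝ)) (ρ : C(prodSet D E, ℝ))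
    (y : E) : ℝ :=
  ∫ z, augmentedInput ρ y z ⬝ᵥ ψ z ∂(lebesgue (prodSet D E))

theorem continuous_pairing [CompactSpace D] [CompactSpace E]
    (ψ : C(prodSet D E, Unit ⊕ Fin r → ℝ)) :
    Continuous fun q : C(prodSet D E, ℝ) × E => pairing ψ q.1 q.2 := by
  refine continuous_integral_lebesgue (F := fun (q : C(prodSet D E, ℝ) × E) z =>
    augmentedInput q.1 q.2 z ⬝ᵥ ψ z) ?_
  exact continuous_augmentedInput.dotProduct (ψ.continuous.comp continuous_snd)

theorem pairing_inl (θ : C(prodSet D E, ℝ)) (ρ : C(prodSet D E, ℝ)) (y : E) :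
    pairing (concat (oneChannel θ) 0) ρ y = ∫ z, ρ z * θ z ∂(lebesgue (prodSet D E)) := by
  refine integral_congr_ae (ae_of_all _ fun z => ?_)
  simp [augmentedInput, concat, oneChannel, dotProduct]

theorem pairing_inr (k : Fin r) (ρ : C(prodSet D E, ℝ)) (y : E) :
    pairing (concat 0 (ContinuousMap.const _ (Pi.single k 1))) ρ y =
      (lebesgue (prodSet D E)).real Set.univ * y.1 k := by
  rw [← smul_eq_mul, ← integral_const]
  refine integral_congr_ae (ae_of_all _ fun z => ?_)
  simp [augmentedInput, concat, dotProduct, Pi.single_apply]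

/-- Networks applied to `σ (∑ j ⟨(ρ, y), ψ j⟩ φ j(x))` are augmented neural operators of depth 1. -/
theorem exists_augmentedNeuralOperator {σ : ℝ → ℝ} (hσ : Continuous σ) {d M : ℕ}
    (ψ : Fin M → C(prodSet D E, Unit ⊕ Fin r → ℝ)) (φ : Fin M → C(D, Fin d → ℝ))
    {N : (Fin m ⊕ Fin d → ℝ) → (Unit → ℝ)} (hN : IsNeuralNetwork σ N) :
    ∃ Φ : C(prodSet D E, ℝ) → E → C(D, ℝ), IsScalarAugmentedNeuralOperator σ 1 Φ ∧
      ∀ ρ y x, Φ ρ y x =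
        N (Sum.elim x.1.ofLp fun i => σ (∑ j, pairing (ψ j) ρ y * φ j x i)) () := by
  -- Hidden layers use channels indexed by `Fin`, so the lifting layer merely relabels channels.
  let e := Fintype.equivFin (Unit ⊕ Fin r)
  let d₀ := Fintype.card (Unit ⊕ Fin r)
  let R : C(prodSet D E, Unit ⊕ Fin r → ℝ) → C(prodSet D E, Fin d₀ → ℝ) := fun f =>
    ⟨fun z i => f z (e.symm i), by fun_prop⟩
  let ψ' : Fin M → C(prodSet D E, Fin d₀ → ℝ) := fun j => R (ψ j)
  let H : C(prodSet D E, Fin d₀ → ℝ) → C(D, Fin d → ℝ) := fun f =>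
    ⟨fun x i => σ (∑ j, (∫ z, f z ⬝ᵥ ψ' j z ∂(lebesgue (prodSet D E))) * φ j x i), by fun_prop⟩
  have hNc := hN.continuous hσ
  let Q : C(D, Fin d → ℝ) → C(D, Unit → ℝ) := fun f =>
    ⟨fun x => N (Sum.elim x.1.ofLp (f x)), hNc.comp (continuous_pi (by
      rintro (i | i)
      · simp only [Sum.elim_inl]; fun_prop
      · simp only [Sum.elim_inr]; fun_prop))⟩
  let V : E → C(prodSet D E, Fin r → ℝ) := fun y => ContinuousMap.const _ y.1.ofLp
  let Φ₁ : C(prodSet D E, Unit → ℝ) → E → C(D, Unit → ℝ) := fun f y =>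
    (Q ∘ H ∘ id ∘ R) (concat f (V y))
  have hRd : ∀ f g z, R f z ⬝ᵥ R g z = f z ⬝ᵥ g z := fun f g z =>
    e.symm.sum_comp fun i => f z i * g z i
  refine ⟨fun ρ y => ⟨fun x => Φ₁ (oneChannel ρ) y x (), by fun_prop⟩,
    ⟨Φ₁, ⟨Fin r, inferInstance, V, _, .identity V 1 fun z x i => ?_,
      ⟨0, d₀, d₀, d, R, id, H, Q, rfl, ?_, .nil, ?_, ⟨N, hN, fun f x => rfl⟩, rfl⟩,
      fun f z => rfl⟩, fun f z => rfl⟩, fun ρ y x => ?_⟩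
  · simp [V]
  · refine ⟨_, .affine (Matrix.fromCols 0 ((1 : Matrix _ _ ℝ).submatrix e.symm id)) 0,
      fun f x => ?_⟩
    ext i
    rw [Matrix.fromCols_mulVec]
    simp [R, Function.comp_def, Matrix.mulVec, dotProduct, Matrix.one_apply]
  -- No bias is needed, since `featureSpan` contains the constants.
  · refine ⟨0, M, fun _ => 1, ψ', φ, fun f x i => ?_⟩
    simp [H]
  · have hp : ∀ j, ∫ z, R (concat (oneChannel ρ) (V y)) z ⬝ᵥ ψ' j z ∂(lebesgue (prodSet D E)) =
        pairing (ψ j) ρ y := fun j => integral_congr_ae (ae_of_all _ fun z => hRd _ _ z)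
    simp only [← hp]
    rfl

/-! ### The feature space on `D × K × E` -/

variable [CompactSpace D] [CompactSpace E] (K : Set C(prodSet D E, ℝ))

/-- The function `(x, ρ, y) ↦ ⟨(ρ, y), ψ⟩ φ(x)` on `D × K × E`. -/
noncomputable def feature (φ : C(D, ℝ)) (ψ : C(prodSet D E, Unit ⊕ Fin r → ℝ)) :
    C(D × K × E, ℝ) where
  toFun p := pairing ψ p.2.1.1 p.2.2 * φ p.1
  continuous_toFun := by
    refine Continuous.mul ?_ (φ.continuous.comp continuous_fst)
    exact (continuous_pairing ψ).comp
      (f := fun p : D × K × E => ((p.2.1 : C(prodSet D E, ℝ)), p.2.2)) (by fun_prop)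

/-- The span of the functions `(x, ρ, y) ↦ ⟨(ρ, y), ψ⟩ φ(x)`. -/
noncomputable def featureSpan : Submodule ℝ C(D × K × E, ℝ) :=
  Submodule.span ℝ (Set.range fun q : C(D, ℝ) × C(prodSet D E, Unit ⊕ Fin r → ℝ) =>
    feature K q.1 q.2)

variable {K}

theorem feature_mem (φ : C(D, ℝ)) (ψ : C(prodSet D E, Unit ⊕ Fin r → ℝ)) :
    feature K φ ψ ∈ featureSpan K :=
  Submodule.subset_span ⟨(φ, ψ), rfl⟩

theorem feature_one_apply (hK : K ⊆ contDensities (prodSet D E)) (φ : C(D, ℝ)) (p : D × K × E) :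
    feature K φ (concat (oneChannel 1) 0) p = φ p.1 := by
  change pairing _ _ _ * _ = _
  rw [pairing_inl]
  simp [(hK p.2.1.2).1]

theorem one_mem_featureSpan (hK : K ⊆ contDensities (prodSet D E)) : 1 ∈ featureSpan K := by
  convert feature_mem (K := K) 1 (concat (oneChannel 1) 0)
  ext p
  rw [feature_one_apply hK]
  rfl

theorem featureSpan_separatesPoints
    (hΩ : prodSet D E ⊆ closure (interior (prodSet D E)))
    (hK : K ⊆ contDensities (prodSet D E)) (p q : D × K × E) (hpq : p ≠ q) :
    ∃ f ∈ featureSpan K, f p ≠ f q := by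
  contrapose! hpq
  obtain ⟨x, ρ, y⟩ := p
  obtain ⟨x', ρ', y'⟩ := q
  have hx : x = x' := by
    ext i
    have := hpq _ (feature_mem (⟨fun x => x.1 i, by fun_prop⟩) (concat (oneChannel 1) 0))
    rw [feature_one_apply hK, feature_one_apply hK] at this
    exact this
  have hf : ∀ ψ, pairing ψ ρ.1 y = pairing ψ ρ'.1 y' := fun ψ => by
    simpa [feature] using hpq _ (feature_mem 1 ψ)
  have hρ : ρ = ρ' := by
    refine Subtype.ext (eq_of_integral_mul_sub_eq hΩ ?_)
    simpa only [pairing_inl] using hf (concat (oneChannel (ρ.1 - ρ'.1)) 0)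
  -- A density of integral one exists, so `D × E` is not null; `pairing_inr` then determines `y`.
  have hvol : (lebesgue (prodSet D E)).real Set.univ ≠ 0 := fun h0 => by
    have h1 := (hK ρ.2).1
    have : lebesgue (prodSet D E) = 0 := by
      rwa [measureReal_eq_zero_iff, Measure.measure_univ_eq_zero] at h0
    simp [this] at h1
  have hy : y = y' := by
    ext k
    have := hf (concat 0 (ContinuousMap.const _ (Pi.single k 1)))
    simpa only [pairing_inr, mul_right_inj' hvol] using this
  rw [hx, hρ, hy]

theorem exists_sum_of_mem_featureSpan {d : ℕ} (s : Fin d → C(D × K × E, ℝ))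
    (hs : ∀ i, s i ∈ featureSpan K) :
    ∃ (M : ℕ) (ψ : Fin M → C(prodSet D E, Unit ⊕ Fin r → ℝ)) (φ : Fin M → C(D, Fin d → ℝ)),
      ∀ (p : D × K × E) i, s i p = ∑ j, pairing (ψ j) p.2.1.1 p.2.2 * φ j p.1 i := by
  choose l a g hsum using fun i => Submodule.mem_span_set'.1 (hs i)
  choose q hq using fun i j => (g i j).2
  let e := Fintype.equivFin (Σ i, Fin (l i))
  -- Each summand of each `s i` becomes one rank-one term whose `φ` is supported in channel `i`.
  refine ⟨_, fun j => (q (e.symm j).1 (e.symm j).2).2, fun j => ⟨fun x =>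
    Pi.single (e.symm j).1 (a (e.symm j).1 (e.symm j).2 * (q (e.symm j).1 (e.symm j).2).1 x),
    (continuous_single _).comp (by fun_prop)⟩, fun p i => ?_⟩
  have he : ∀ (F : (Σ i, Fin (l i)) → ℝ), ∑ j, F (e.symm j) = ∑ i, ∑ j, F ⟨i, j⟩ := fun F => by
    rw [e.symm.sum_comp, Fintype.sum_sigma]
  refine Eq.trans ?_ (he fun c => pairing (q c.1 c.2).2 p.2.1.1 p.2.2 *
    (Pi.single c.1 (a c.1 c.2 * (q c.1 c.2).1 p.1) : Fin d → ℝ) i).symm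
  rw [Finset.sum_eq_single i]
  · rw [← hsum]
    simp only [ContinuousMap.sum_apply, ContinuousMap.smul_apply, smul_eq_mul, ← hq,
      Pi.single_eq_same]
    refine Finset.sum_congr rfl fun j _ => ?_
    change a i j * (pairing _ _ _ * _) = _
    ring
  · intro i' _ hi'
    simp [Pi.single_eq_of_ne hi'.symm]
  · simp

theorem continuous_marginal :
    Continuous fun q : C(prodSet D E, ℝ) × E => marginal q.1 q.2 := by
  refine continuous_integral_lebesgue (F := fun (q : C(prodSet D E, ℝ) × E) x =>
    q.1 (pairIn x q.2)) ?_
  have : Continuous fun q : (C(prodSet D E, ℝ) × E) × D => pairIn q.2 q.1.2 :=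
    continuous_pairIn.comp (continuous_snd.prodMk (continuous_snd.comp continuous_fst))
  exact (continuous_fst.comp continuous_fst).eval this

/-- The conditioning operator as a function of `(x, ρ, y) ∈ D × K × E`. -/
noncomputable def inContextMap {δ : ℝ} (hδ : 0 < δ) (hK : K ⊆ boundedBelow D E δ) :
    C(D × K × E, ℝ) where
  toFun p := inContext p.2.1.1 p.2.2 p.1
  continuous_toFun := by
    have h1 : Continuous fun p : D × K × E => pairIn p.1 p.2.2 :=
      continuous_pairIn.comp (by fun_prop : Continuous fun p : D × K × E => (p.1, p.2.2))
    have h2 : Continuous fun p : D × K × E => marginal p.2.1.1 p.2.2 :=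
      continuous_marginal.comp
        (by fun_prop : Continuous fun p : D × K × E => ((p.2.1 : C(prodSet D E, ℝ)), p.2.2))
    refine Continuous.div (Continuous.eval (by fun_prop) h1) h2 fun p => ?_
    exact (hδ.trans_le ((hK p.2.1.2).2 p.2.2)).ne'

end Operator

end Conditioning

theorem mainTheorem2 (m r : ℕ)
    (D : Set (EuclideanSpace ℝ (Fin m))) (E : Set (EuclideanSpace ℝ (Fin r)))
    [CompactSpace D] [CompactSpace E]
    (hD : Conditioning.HasLipschitzBoundary D) (hE : Conditioning.HasLipschitzBoundary E)
    (σ : ℝ → ℝ) (hσ : Continuous σ) (hσ_nonlinear : ¬ ∃ a b : ℝ, ∀ t, σ t = a * t + b)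
    (δ : ℝ) (hδ : 0 < δ)
    (K : Set C(Conditioning.prodSet D E, ℝ)) (hK : IsCompact K)
    (hKδ : K ⊆ Conditioning.boundedBelow D E δ)
    (ε : ℝ) (hε : 0 < ε) :
    ∃ (L : ℕ) (Φ : C(Conditioning.prodSet D E, ℝ) → E → C(D, ℝ)),
      0 < L ∧ Conditioning.IsScalarAugmentedNeuralOperator σ L Φ ∧
      ∀ ρ ∈ K, ∀ y : E, ‖Conditioning.inContext ρ y - Φ ρ y‖ ≤ ε := by
  have hKd : K ⊆ Conditioning.contDensities (Conditioning.prodSet D E) := fun ρ hρ => (hKδ hρ).1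
  have : CompactSpace K := isCompact_iff_compactSpace.1 hK
  obtain ⟨n, g, hg, hlt⟩ := Conditioning.exists_mem_deepSpan_norm_sub_lt (σ := ⟨σ, hσ⟩)
    hσ_nonlinear (Conditioning.one_mem_featureSpan hKd)
    (Conditioning.featureSpan_separatesPoints
      (Conditioning.prodSet_subset_closure_interior hD.subset_closure_interior
        hE.subset_closure_interior) hKd)
    (Conditioning.inContextMap hδ hKδ) hε
  obtain ⟨d, s, N, hs, hN, hgN⟩ := Conditioning.exists_network_of_mem_deepSpan (Fin m) n
    (fun _ : Unit => g) fun _ => hg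
  obtain ⟨M, ψ, φ, hsum⟩ := Conditioning.exists_sum_of_mem_featureSpan s hs
  obtain ⟨Φ, hΦ, hΦN⟩ := Conditioning.exists_augmentedNeuralOperator hσ ψ φ hN
  refine ⟨1, Φ, one_pos, hΦ, fun ρ hρ y => (ContinuousMap.norm_le _ hε.le).2 fun x => ?_⟩
  have hx : Φ ρ y x = g (x, ⟨ρ, hρ⟩, y) := by
    rw [hΦN, hgN x.1.ofLp (x, ⟨ρ, hρ⟩, y) ()]
    simp only [hsum]
    rfl
  have h := ContinuousMap.norm_coe_le_norm (Conditioning.inContextMap hδ hKδ - g) (x, ⟨ρ, hρ⟩, y)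
  rw [ContinuousMap.sub_apply, hx]
  exact h.trans hlt.le
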